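/- Let $(Q,\mathfrak n,k)$ be a commutative Noetherian local ring and let $\varphi\colon Q\to R$ be a surjective homomorphism onto a (nonzero, hence local) ring $R$. For a local ring $S\in\{Q,R\}$ (both have residue field $k$) and a finitely generated $S$-module $N$, let $$P^S_N(t)=\sum_{n\ge 0}\dim_k \operatorname{Tor}^S_n(N,k)\,t^n$$ be its Poincaré series. A finitely generated $R$-module $M$ is called $\varphi$-Golod if $$P^R_M(t)=\frac{P^Q_M(t)}{1-t\left(P^Q_R(t)-1\right)}$$ as formal power series. Let $M$ be a $\varphi$-Golod $R$-module, and let $\varepsilon\colon G_0\to M$ be the augmentation of a minimal $Q$-free resolution of $M$; that is, $G_0$ is a finitely generated free $Q$-module and $\varepsilon$ is a surjective $Q$-linear map with $\ker\varepsilon\subseteq\mathfrak n G_0$. Let $$\operatorname{syz}^R M=\ker\left(R\otimes_Q G_0\to M,\quad r\otimes g\mapsto r\,\varepsilon(g)\right)$$ be the first $R$-syzygy of $M$. Then $\operatorname{syz}^R M$ is also $\varphi$-Golod. -/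

import Mathlib

universe u

noncomputable section

namespace GolodMod

open CategoryTheory MonoidalCategory TensorProduct PowerSeries

section Poincare

variable (S : Type u) [CommRing S] [IsLocalRing S] (M : Type u) [AddCommGroup M] [Module S M]

/-- `Tor_n^S(M, k)`, where `k` is the residue field of the local ring `S`: the `n`-th homology of
`P ⊗ k`, for a projective resolution `P` of `M`. -/
abbrev TorResidue (n : ℕ) : Type u :=
  (((Tor' (ModuleCat.{u} S) n).obj (ModuleCat.of S M)).obj
    (ModuleCat.of S (IsLocalRing.ResidueField S)) : ModuleCat.{u} S)

lemma torResidue_isTorsion (n : ℕ) :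
    Module.IsTorsionBySet S (TorResidue S M n) (IsLocalRing.maximalIdeal S) := by
  rintro x ⟨r, hr⟩
  let k : ModuleCat.{u} S := ModuleCat.of S (IsLocalRing.ResidueField S)
  let P := ProjectiveResolution.of (ModuleCat.of S M)
  let K := (((tensoringRight (ModuleCat.{u} S)).obj k).mapHomologicalComplex _).obj P.complex
  let e : (((Tor' (ModuleCat.{u} S) n).obj (ModuleCat.of S M)).obj k) ≅ (K.sc n).homology :=
    P.isoLeftDerivedObj ((tensoringRight (ModuleCat.{u} S)).obj k) n
  have hk : r • 𝟙 k = 0 := by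
    ext y
    obtain ⟨y, rfl⟩ := IsLocalRing.residue_surjective y
    change r • IsLocalRing.residue S y = 0
    rw [Algebra.smul_def]
    change IsLocalRing.residue S r * _ = 0
    rw [(IsLocalRing.residue_eq_zero_iff r).2 hr, zero_mul]
  have hX : ∀ X : ModuleCat.{u} S, r • 𝟙 (X ⊗ k) = 0 := fun X => by
    rw [← MonoidalCategory.whiskerLeft_id, ← MonoidalLinear.whiskerLeft_smul, hk,
      MonoidalPreadditive.whiskerLeft_zero]
  have hsc : r • 𝟙 (K.sc n) = 0 := by
    ext1 <;> exact hX _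
  have hH : r • 𝟙 ((K.sc n).homology) = 0 := by
    rw [← ShortComplex.homologyMap_id, ← ShortComplex.homologyMap_smul, hsc,
      ShortComplex.homologyMap_zero]
  have h0 : r • e.hom.hom x = 0 := by
    have := congrArg (fun f => (ModuleCat.Hom.hom f) (e.hom.hom x)) hH
    exact this
  have h1 : e.hom.hom (r • x) = 0 := by rw [map_smul, h0]
  have h2 := congrArg e.inv.hom h1
  rw [map_zero] at h2
  have h3 : e.inv.hom (e.hom.hom (r • x)) = r • x := by
    exact congrArg (fun f => (ModuleCat.Hom.hom f) (r • x)) e.hom_inv_id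
  exact h3.symm.trans h2

/-- The natural vector space structure of `Tor_n^S(M, k)` over `k = S / 𝔪`. -/
instance (n : ℕ) : Module (IsLocalRing.ResidueField S) (TorResidue S M n) :=
  (torResidue_isTorsion S M n).module

/-- The two scalar actions on `Tor_n^S(M, k)` agree: `(r mod 𝔪) • x = r • x`. -/
lemma residue_smul_torResidue (n : ℕ) (r : S) (x : TorResidue S M n) :
    IsLocalRing.residue S r • x = r • x := rfl

/-- The Poincaré series `P^S_M(t) = ∑ₙ dim_k Tor_n^S(M, k) tⁿ`. -/
def poincareSeries : ℚ⟦X⟧ :=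
  PowerSeries.mk fun n =>
    (Module.finrank (IsLocalRing.ResidueField S) (TorResidue S M n) : ℚ)

end Poincare

section Golod

variable (Q R : Type u) [CommRing Q] [IsLocalRing Q] [CommRing R] [IsLocalRing R] [Algebra Q R]
  (M : Type u) [AddCommGroup M] [Module Q M] [Module R M]

/-- The Golod bound `P^Q_M(t) / (1 - t (P^Q_R(t) - 1))`. The denominator has constant term `1`, so
`⁻¹` is its inverse as a power series. -/
def golodBound : ℚ⟦X⟧ :=
  poincareSeries Q M * (1 - X * (poincareSeries Q R - 1))⁻¹

/-- The `R`-module `M` is a Golod module with respect to `Q → R`: it is finitely generated and its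
Poincaré series over `R` is equal to the Golod bound. -/
def IsGolod : Prop :=
  Module.Finite R M ∧ poincareSeries R M = golodBound Q R M

end Golod

section Syzygy

variable {Q : Type u} (R : Type u) [CommRing Q] [CommRing R] [Algebra Q R]
  {M : Type u} [AddCommGroup M] [Module Q M] [Module R M] [IsScalarTower Q R M]
  {G₀ : Type u} [AddCommGroup G₀] [Module Q G₀]

/-- `ε : G₀ → M` is the augmentation of a minimal free resolution of the finitely generated module
`M` over the local ring `Q`: `G₀` is finite free, and `ε` is onto with kernel inside `𝔪 G₀`. -/
structure IsMinimalFreeCover [IsLocalRing Q] (ε : G₀ →ₗ[Q] M) : Prop where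
  free : Module.Free Q G₀
  finite : Module.Finite Q G₀
  surjective : Function.Surjective ε
  ker_le : LinearMap.ker ε ≤ IsLocalRing.maximalIdeal Q • (⊤ : Submodule Q G₀)

/-- The first syzygy over `R`: the kernel of the map `R ⊗_Q G₀ → M`, `r ⊗ g ↦ r ε(g)`. -/
abbrev syzygy (ε : G₀ →ₗ[Q] M) : Submodule R (R ⊗[Q] G₀) :=
  LinearMap.ker (ε.liftBaseChange R)

end Syzygy

end GolodMod

end

/-! Write `≤` coefficientwise and let g be the rank of `G₀`. Everything rests on one inequality over
`Q`: t·P^Q_{syz M} ≤ P^Q_M − g(1 − t(P^Q_R − 1)). The kernel of `G₀ → R ⊗ G₀` is a first `Q`-syzygy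
of `R ⊗ G₀ ≅ R^g`, it lies in ker ε, a first `Q`-syzygy of M, and the quotient is syz M. The long
exact sequence of Tor then gives the inequality (`coeff_X_mul_poincareSeries_syzygy_le`).
Multiplying by 1/(1 − t(P^Q_R − 1)), whose coefficients are nonnegative, bounds t times the Golod
bound of syz M by the Golod bound of M minus g (`coeff_X_mul_golodBound_syzygy_le`). Over `R`,
minimality gives the equality t·P^R_{syz M} = P^R_M − g (`X_mul_poincareSeries_syzygy`). Comparing
the two by induction on the degree yields Serre's bound for every module. If M attains its bound,
the same comparison forces syz M to attain its own. -/

noncomputable section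

namespace GolodMod

open CategoryTheory MonoidalCategory TensorProduct PowerSeries

/-! ### Splicing projective resolutions -/

section Augment

variable {C : Type*} [Category* C] [Abelian C]

/-- The augmentation of a projective resolution. -/
def augmentation {Z : C} (P : ProjectiveResolution Z) : P.complex.X 0 ⟶ Z := P.π.f 0

theorem d_comp_augmentation {Z : C} (P : ProjectiveResolution Z) :
    P.complex.d 1 0 ≫ augmentation P = 0 :=
  P.complex_d_comp_π_f_zero

instance {Z : C} (P : ProjectiveResolution Z) : Epi (augmentation P) :=
  inferInstanceAs (Epi (P.π.f 0))

theorem d_comp_augmentation_comp {Z Y : C} (P : ProjectiveResolution Z) (f : Z ⟶ Y) :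
    P.complex.d 1 0 ≫ augmentation P ≫ f = 0 := by
  rw [← Category.assoc, d_comp_augmentation, Limits.zero_comp]

theorem exact_augmentation_comp {Z Y : C} (P : ProjectiveResolution Z) (f : Z ⟶ Y) [Mono f] :
    (ShortComplex.mk _ _ (d_comp_augmentation_comp P f)).Exact := by
  let β : ShortComplex.mk _ _ (d_comp_augmentation P) ⟶
      ShortComplex.mk _ _ (d_comp_augmentation_comp P f) :=
    { τ₁ := 𝟙 _
      τ₂ := 𝟙 _
      τ₃ := f }
  have h1 : Epi β.τ₁ := inferInstanceAs (Epi (𝟙 _))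
  have h2 : IsIso β.τ₂ := inferInstanceAs (IsIso (𝟙 _))
  have h3 : Mono β.τ₃ := inferInstanceAs (Mono f)
  exact (ShortComplex.exact_iff_of_epi_of_isIso_of_mono β).1 P.exact₀

theorem augmentation_comp_exact (T : ShortComplex C) (hT : T.Exact)
    (P : ProjectiveResolution T.X₁) :
    (ShortComplex.mk (augmentation P ≫ T.f) T.g (by
      rw [Category.assoc, T.zero, Limits.comp_zero])).Exact := by
  let α : ShortComplex.mk (augmentation P ≫ T.f) T.g (by
      rw [Category.assoc, T.zero, Limits.comp_zero]) ⟶ T :=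
    { τ₁ := augmentation P
      τ₂ := 𝟙 _
      τ₃ := 𝟙 _ }
  have h1 : Epi α.τ₁ := inferInstanceAs (Epi (augmentation P))
  have h2 : IsIso α.τ₂ := inferInstanceAs (IsIso (𝟙 _))
  have h3 : Mono α.τ₃ := inferInstanceAs (Mono (𝟙 _))
  exact (ShortComplex.exact_iff_of_epi_of_isIso_of_mono α).2 hT

/-- Splicing a projective resolution of `X₁` with a short exact sequence `0 → X₁ → X₂ → X₃ → 0`
with `X₂` projective gives a projective resolution of `X₃`. -/
def spliceResolution (T : ShortComplex C) (hT : T.ShortExact) [Projective T.X₂]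
    (P : ProjectiveResolution T.X₁) : ProjectiveResolution T.X₃ where
  complex := P.complex.augment _ (d_comp_augmentation_comp P T.f)
  projective n := by
    cases n
    · assumption
    · exact P.projective _
  π := (ChainComplex.toSingle₀Equiv _ _).symm ⟨T.g, by
    change (augmentation P ≫ T.f) ≫ T.g = 0
    rw [Category.assoc, T.zero, Limits.comp_zero]⟩
  quasiIso := ⟨fun n => by
    have := hT.epi_g
    have := hT.mono_f
    rcases n with _ | _ | n
    · rw [ChainComplex.quasiIsoAt₀_iff, ShortComplex.quasiIso_iff_of_zeros']
      · refine (ShortComplex.exact_and_epi_g_iff_of_iso ?_).2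
          ⟨augmentation_comp_exact T hT.exact P, hT.epi_g⟩
        refine ShortComplex.isoMk (Iso.refl _) (Iso.refl _) (Iso.refl _) ?_ ?_
        · exact (Category.id_comp _).trans (Category.comp_id _).symm
        · refine (Category.id_comp _).trans (Eq.trans ?_ (Category.comp_id _).symm)
          exact (ChainComplex.toSingle₀Equiv_symm_apply_f_zero
            (C := P.complex.augment _ (d_comp_augmentation_comp P T.f)) T.g _).symm
      all_goals rfl
    · rw [quasiIsoAt_iff_exactAt']
      · rw [HomologicalComplex.exactAt_iff' _ 2 1 0 (by simp) (by simp)]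
        exact exact_augmentation_comp P T.f
      · apply ChainComplex.exactAt_succ_single_obj
    · rw [quasiIsoAt_iff_exactAt']
      · rw [HomologicalComplex.exactAt_iff' _ (n + 3) (n + 2) (n + 1) (by simp) (by simp)]
        exact P.exact_succ n
      · apply ChainComplex.exactAt_succ_single_obj⟩

end Augment

/-! ### Dimension shifting for the length of Tor -/

section TorLen

variable (S : Type u) [CommRing S] [IsLocalRing S] (M : Type u) [AddCommGroup M] [Module S M]

/-- The length of `Tor_n^S(M, k)`. -/
def torLength (n : ℕ) : ℕ∞ := Module.length S (TorResidue S M n)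

variable {S M}

/-- The functor `- ⊗ k` on modules over a local ring with residue field `k`. -/
abbrev tensorResidue (S : Type u) [CommRing S] [IsLocalRing S] : ModuleCat.{u} S ⥤ ModuleCat.{u} S :=
  (tensoringRight (ModuleCat.{u} S)).obj (ModuleCat.of S (IsLocalRing.ResidueField S))

theorem torLength_eq_of_resolution (P : ProjectiveResolution (ModuleCat.of S M)) (i n j : ℕ)
    (hi : (ComplexShape.down ℕ).prev n = i) (hj : (ComplexShape.down ℕ).next n = j) :
    torLength S M n = Module.length S
      (((((tensorResidue S).mapHomologicalComplex _).obj P.complex).sc' i n j).homology) := by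
  have e : (((Tor' (ModuleCat.{u} S) n).obj (ModuleCat.of S M)).obj
      (ModuleCat.of S (IsLocalRing.ResidueField S))) ≅ _ :=
    P.isoLeftDerivedObj (tensorResidue S) n
  have e2 := (((tensorResidue S).mapHomologicalComplex _).obj P.complex).homologyIsoSc' i n j hi hj
  exact (e.trans e2).toLinearEquiv.length_eq

-- Both homologies embed in coker u, and the one with w = 0 is all of it. It compares the bottom of
-- a spliced complex with that of the original, in either direction.
omit [IsLocalRing S] in
theorem length_homology_le {X₁ X₂ X₃ X₄ : ModuleCat.{u} S} (u : X₁ ⟶ X₂) (v : X₂ ⟶ X₃)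
    (w : X₂ ⟶ X₄) (hv : u ≫ v = 0) (hw : u ≫ w = 0) (h : w = 0) :
    Module.length S (ShortComplex.mk u v hv).homology ≤
      Module.length S (ShortComplex.mk u w hw).homology := by
  let φ : ShortComplex.mk u v hv ⟶ ShortComplex.mk u w hw :=
    { τ₁ := 𝟙 _, τ₂ := 𝟙 _, τ₃ := 0, comm₂₃ := by simp [h] }
  have h := ShortComplex.isIso_opcyclesMap_of_isIso_of_epi' φ
    (inferInstanceAs (IsIso (𝟙 _))) (inferInstanceAs (Epi (𝟙 _)))
  have := ShortComplex.mono_homologyMap_of_mono_opcyclesMap' φ inferInstance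
  exact Module.length_le_of_injective (ShortComplex.homologyMap φ).hom
    ((ModuleCat.mono_iff_injective _).1 this)

variable {K F : Type u} [AddCommGroup K] [Module S K] [AddCommGroup F] [Module S F]
  {f : K →ₗ[S] F} {g : F →ₗ[S] M}

omit [IsLocalRing S] in
theorem shortExact_ofHom (hf : Function.Injective f) (hfg : Function.Exact f g)
    (hg : Function.Surjective g) :
    (ShortComplex.mk (ModuleCat.ofHom f) (ModuleCat.ofHom g)
      (by ext x; exact hfg.apply_apply_eq_zero x)).ShortExact where
  exact := (ShortComplex.ShortExact.moduleCat_exact_iff_function_exact _).2 hfg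
  mono_f := (ModuleCat.mono_iff_injective _).2 hf
  epi_g := (ModuleCat.epi_iff_surjective _).2 hg

theorem whiskerRight_residue_eq_zero
    (h : LinearMap.range f ≤ IsLocalRing.maximalIdeal S • (⊤ : Submodule S F)) :
    (tensorResidue S).map (ModuleCat.ofHom f) = 0 := by
  have key : ∀ y ∈ IsLocalRing.maximalIdeal S • (⊤ : Submodule S F),
      ∀ c : IsLocalRing.ResidueField S, y ⊗ₜ[S] c = 0 := by
    intro y hy c
    induction hy using Submodule.smul_induction_on' with
    | smul r hr n hn =>
      rw [TensorProduct.smul_tmul, Algebra.smul_def,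
        IsLocalRing.ResidueField.algebraMap_eq, (IsLocalRing.residue_eq_zero_iff r).2 hr, zero_mul,
        TensorProduct.tmul_zero]
    | add x hx y hy h1 h2 => rw [TensorProduct.add_tmul, h1, h2, add_zero]
  have : f.rTensor (IsLocalRing.ResidueField S) = 0 := by
    ext x c
    exact key _ (h ⟨x, rfl⟩) _
  ext x
  exact LinearMap.congr_fun this x

theorem torLength_succ_le [Module.Projective S F] (hf : Function.Injective f)
    (hfg : Function.Exact f g) (hg : Function.Surjective g) (n : ℕ) :
    torLength S M (n + 1) ≤ torLength S K n := by
  let T := ShortComplex.mk (ModuleCat.ofHom f) (ModuleCat.ofHom g)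
      (by ext x; exact hfg.apply_apply_eq_zero x)
  have : Projective T.X₂ := (ModuleCat.of S F).projective_of_categoryTheory_projective
  let P : ProjectiveResolution (ModuleCat.of S K) := ProjectiveResolution.of _
  let P' : ProjectiveResolution (ModuleCat.of S M) :=
    spliceResolution T (shortExact_ofHom hf hfg hg) P
  rcases n with _ | n
  · rw [torLength_eq_of_resolution P' 2 1 0 (by simp) (by simp),
      torLength_eq_of_resolution P 1 0 0 (by simp) (by simp)]
    -- In `ComplexShape.down ℕ` the successor of 0 is 0 itself, so the outgoing map in degree 0 is
    -- `d 0 0`, which vanishes.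
    exact length_homology_le _ _ _ _ _ (by
      rw [Functor.mapHomologicalComplex_obj_d, P.complex.shape 0 0 (by simp), Functor.map_zero]; rfl)
  · rw [torLength_eq_of_resolution P' (n + 3) (n + 2) (n + 1) (by simp) (by simp),
      torLength_eq_of_resolution P (n + 2) (n + 1) n (by simp) (by simp)]
    exact le_rfl

theorem torLength_succ_eq [Module.Projective S F] (hf : Function.Injective f)
    (hfg : Function.Exact f g) (hg : Function.Surjective g)
    (h : LinearMap.range f ≤ IsLocalRing.maximalIdeal S • (⊤ : Submodule S F)) (n : ℕ) :
    torLength S M (n + 1) = torLength S K n := by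
  refine le_antisymm (torLength_succ_le hf hfg hg n) ?_
  let T := ShortComplex.mk (ModuleCat.ofHom f) (ModuleCat.ofHom g)
      (by ext x; exact hfg.apply_apply_eq_zero x)
  have : Projective T.X₂ := (ModuleCat.of S F).projective_of_categoryTheory_projective
  let P : ProjectiveResolution (ModuleCat.of S K) := ProjectiveResolution.of _
  let P' : ProjectiveResolution (ModuleCat.of S M) :=
    spliceResolution T (shortExact_ofHom hf hfg hg) P
  rcases n with _ | n
  · rw [torLength_eq_of_resolution P' 2 1 0 (by simp) (by simp),
      torLength_eq_of_resolution P 1 0 0 (by simp) (by simp)]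
    -- Minimality kills the map into `F ⊗ k`, so the spliced complex now plays the role of w = 0.
    exact length_homology_le _ _ _ _ _ (by
      change (tensorResidue S).map (augmentation P ≫ ModuleCat.ofHom f) = 0
      rw [Functor.map_comp, whiskerRight_residue_eq_zero h, Limits.comp_zero])
  · rw [torLength_eq_of_resolution P' (n + 3) (n + 2) (n + 1) (by simp) (by simp),
      torLength_eq_of_resolution P (n + 2) (n + 1) n (by simp) (by simp)]
    exact le_rfl

end TorLen

/-! ### Minimal covers and inequalities from short exact sequences -/

section TorLength

variable {S : Type u} [CommRing S] [IsLocalRing S] {M : Type u} [AddCommGroup M] [Module S M]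
  {K F : Type u} [AddCommGroup K] [Module S K] [AddCommGroup F] [Module S F]

theorem torLength_congr (e : M ≃ₗ[S] F) (n : ℕ) : torLength S M n = torLength S F n :=
  (((Tor' (ModuleCat.{u} S) n).mapIso e.toModuleIso).app _).toLinearEquiv.length_eq

variable (S M) in
theorem torLength_zero :
    torLength S M 0 = Module.length S (M ⊗[S] IsLocalRing.ResidueField S) :=
  ((tensorResidue S).leftDerivedZeroIsoSelf.app (ModuleCat.of S M)).toLinearEquiv.length_eq

theorem torLength_zero_le_of_surjective (g : F →ₗ[S] M) (hg : Function.Surjective g) :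
    torLength S M 0 ≤ torLength S F 0 := by
  rw [torLength_zero, torLength_zero]
  exact Module.length_le_of_surjective _ (LinearMap.rTensor_surjective _ hg)

theorem rTensor_residue_eq_zero {f : K →ₗ[S] F}
    (h : LinearMap.range f ≤ IsLocalRing.maximalIdeal S • (⊤ : Submodule S F)) :
    f.rTensor (IsLocalRing.ResidueField S) = 0 :=
  congrArg ModuleCat.Hom.hom (whiskerRight_residue_eq_zero h)

theorem length_residueField : Module.length S (IsLocalRing.ResidueField S) = 1 := by
  rw [Module.length_eq_of_surjective (S := S) (R := IsLocalRing.ResidueField S)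
    (IsLocalRing.residue_surjective), Module.length_eq_one]

theorem length_tensor_residueField [Module.Free S F] [Module.Finite S F] :
    Module.length S (F ⊗[S] IsLocalRing.ResidueField S) = Module.finrank S F := by
  let e : F ≃ₗ[S] (Fin (Module.finrank S F) → S) := (Module.finBasis S F).equivFun
  rw [((TensorProduct.comm S _ _).trans ((TensorProduct.congr (LinearEquiv.refl S _) e).trans
    (TensorProduct.piScalarRight S S _ _))).length_eq, Module.length_pi, length_residueField]
  simp

theorem torLength_zero_eq_finrank [Module.Free S F] [Module.Finite S F] {g : F →ₗ[S] M}
    (hg : Function.Surjective g)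
    (h : LinearMap.ker g ≤ IsLocalRing.maximalIdeal S • (⊤ : Submodule S F)) :
    torLength S M 0 = Module.finrank S F := by
  rw [torLength_zero, ← length_tensor_residueField]
  refine (LinearEquiv.length_eq (LinearEquiv.ofBijective (g.rTensor _)
    ⟨?_, LinearMap.rTensor_surjective _ hg⟩)).symm
  have hex := rTensor_exact (IsLocalRing.ResidueField S) (LinearMap.exact_subtype_ker_map g) hg
  rw [rTensor_residue_eq_zero (by simpa using h)] at hex
  exact (hex.linearMap_ker_eq).trans LinearMap.range_zero |> LinearMap.ker_eq_bot.1

-- Lift a k-basis of `k ⊗ M`: Nakayama gives surjectivity, and independence of the basis puts every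
-- relation in the maximal ideal.
variable (S M) in
theorem exists_minimal_cover [Module.Finite S M] :
    ∃ (n : ℕ) (g : (Fin n → S) →ₗ[S] M), Function.Surjective g ∧
      LinearMap.ker g ≤ IsLocalRing.maximalIdeal S • (⊤ : Submodule S (Fin n → S)) := by
  let k := IsLocalRing.ResidueField S
  let b := Module.finBasis k (k ⊗[S] M)
  choose f hf using fun i =>
    TensorProduct.mk_surjective S M k Ideal.Quotient.mk_surjective (b i)
  refine ⟨_, Fintype.linearCombination S f, ?_, ?_⟩
  · rw [← LinearMap.range_eq_top, Fintype.range_linearCombination]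
    exact IsLocalRing.span_eq_top_of_tmul_eq_basis f b hf
  · intro x hx
    have h1 : ∑ i, (IsLocalRing.residue S (x i)) • b i = 0 := by
      have : (1 : k) ⊗ₜ[S] (Fintype.linearCombination S f x) = 0 := by
        rw [LinearMap.mem_ker.1 hx, TensorProduct.tmul_zero]
      rw [Fintype.linearCombination_apply, TensorProduct.tmul_sum] at this
      rw [← this]
      refine Finset.sum_congr rfl fun i _ => ?_
      rw [TensorProduct.tmul_smul, ← hf i]
      rfl
    have h2 := Fintype.linearIndependent_iff.1 b.linearIndependent _ h1
    rw [← (Pi.basisFun S _).sum_repr x]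
    refine Submodule.sum_mem _ fun i _ => Submodule.smul_mem_smul ?_ trivial
    simpa using (IsLocalRing.residue_eq_zero_iff _).1 (h2 i)

theorem torLength_of_subsingleton [Subsingleton M] (n : ℕ) : torLength S M n = 0 := by
  induction n with
  | zero => rw [torLength_zero, Module.length_eq_zero]
  | succ n ih =>
    refine le_antisymm ((torLength_succ_le (f := (0 : M →ₗ[S] M)) (g := (0 : M →ₗ[S] M))
      (Function.injective_of_subsingleton _) ?_ (Function.surjective_to_subsingleton _) n).trans
      ih.le) zero_le
    intro x
    exact ⟨fun _ => ⟨0, Subsingleton.elim _ _⟩, fun _ => Subsingleton.elim _ _⟩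

theorem torLength_ne_top [IsNoetherianRing S] [Module.Finite S M] (n : ℕ) :
    torLength S M n ≠ ⊤ := by
  obtain ⟨m, g, hg, hk⟩ := exists_minimal_cover S M
  induction n generalizing M m with
  | zero => rw [torLength_zero_eq_finrank hg hk]; exact ENat.natCast_ne_top _
  | succ n ih =>
    rw [torLength_succ_eq (Submodule.injective_subtype _) (LinearMap.exact_subtype_ker_map g) hg
      (by simpa using hk)]
    obtain ⟨m', g', hg', hk'⟩ := exists_minimal_cover S (LinearMap.ker g)
    exact ih m' g' hg' hk'

/-- `Tor_n(-, k)` is half exact. -/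
theorem torLength_le_add [IsNoetherianRing S] {A B C : Type u} [AddCommGroup A] [Module S A]
    [AddCommGroup B] [Module S B] [AddCommGroup C] [Module S C] [Module.Finite S A]
    [Module.Finite S C] {f : A →ₗ[S] B} {g : B →ₗ[S] C} (hf : Function.Injective f)
    (hfg : Function.Exact f g) (hg : Function.Surjective g) (n : ℕ) :
    torLength S B n ≤ torLength S A n + torLength S C n := by
  induction n generalizing A B C with
  | zero =>
    rw [torLength_zero, torLength_zero, torLength_zero]
    have h1 := rTensor_exact (IsLocalRing.ResidueField S) hfg hg
    rw [Module.length_eq_add_of_exact (Submodule.subtype _)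
      (g.rTensor (IsLocalRing.ResidueField S)) (Submodule.injective_subtype _)
      (LinearMap.rTensor_surjective _ hg) (LinearMap.exact_subtype_ker_map _),
      h1.linearMap_ker_eq]
    exact add_le_add_left (Module.length_le_of_surjective _ (LinearMap.surjective_rangeRestrict _)) _
  | succ n ih =>
    obtain ⟨a, p, hp, hpk⟩ := exists_minimal_cover S A
    obtain ⟨c, q, hq, hqk⟩ := exists_minimal_cover S C
    obtain ⟨l, hl⟩ := Module.projective_lifting_property g q hg
    have hl' : ∀ y, g (l y) = q y := LinearMap.congr_fun hl
    have hgf : ∀ y, g (f y) = 0 := hfg.apply_apply_eq_zero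
    -- Horseshoe construction: ker h is an extension of ker q by ker p. This cover of B need not be
    -- minimal, but B only needs the inequality `torLength_succ_le`.
    let h : ((Fin a → S) × (Fin c → S)) →ₗ[S] B := (f ∘ₗ p).coprod l
    have hh : Function.Surjective h := by
      intro b
      obtain ⟨y, hy⟩ := hq (g b)
      obtain ⟨z, hz⟩ := (hfg (b - l y)).1 (by rw [map_sub, hl', hy, sub_self])
      obtain ⟨x, rfl⟩ := hp z
      exact ⟨(x, y), by simp [h, hz]⟩
    let u : LinearMap.ker p →ₗ[S] LinearMap.ker h :=
      ((LinearMap.inl S _ _) ∘ₗ (LinearMap.ker p).subtype).codRestrict _ (fun x => by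
        simp [h])
    let v : LinearMap.ker h →ₗ[S] LinearMap.ker q :=
      ((LinearMap.snd S _ _) ∘ₗ (LinearMap.ker h).subtype).codRestrict _ (fun x => by
        have hx : f (p x.1.1) + l x.1.2 = 0 := x.2
        have := congrArg g hx
        rwa [map_add, hgf, zero_add, hl', map_zero] at this)
    have key := ih (f := u) (g := v)
      (fun x y hxy => Subtype.ext (congrArg (fun z => z.1.1) hxy))
      (by
        rintro ⟨⟨x, y⟩, hxy⟩
        constructor
        · intro h0
          obtain rfl : y = 0 := congrArg Subtype.val h0
          refine ⟨⟨x, hf ?_⟩, rfl⟩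
          simpa [h] using hxy
        · rintro ⟨z, hz⟩
          exact Subtype.ext (congrArg (fun w => w.1.2) hz).symm)
      (by
        rintro ⟨y, hy⟩
        obtain ⟨z, hz⟩ := (hfg (l y)).1 (by rw [hl']; exact hy)
        obtain ⟨x, rfl⟩ := hp z
        exact ⟨⟨(-x, y), by simp [h, hz]⟩, rfl⟩)
    rw [torLength_succ_eq (Submodule.injective_subtype _) (LinearMap.exact_subtype_ker_map p) hp
      (by simpa using hpk), torLength_succ_eq (Submodule.injective_subtype _)
      (LinearMap.exact_subtype_ker_map q) hq (by simpa using hqk)]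
    exact (torLength_succ_le (Submodule.injective_subtype _) (LinearMap.exact_subtype_ker_map h)
      hh n).trans key

omit [IsLocalRing S] in
theorem exists_ker_comp_to_syzygy {P N N' : Type u} [AddCommGroup P] [Module S P]
    [AddCommGroup N] [Module S N] [AddCommGroup N'] [Module S N'] {p : P →ₗ[S] F} {i : N' →ₗ[S] F}
    {g : F →ₗ[S] N} (hp : Function.Surjective p) (hi : Function.Injective i)
    (hig : Function.Exact i g) :
    ∃ v : LinearMap.ker (g ∘ₗ p) →ₗ[S] N', Function.Surjective v ∧ ∀ x, i (v x) = p x := by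
  let v : LinearMap.ker (g ∘ₗ p) →ₗ[S] N' := (LinearEquiv.ofInjective i hi).symm.toLinearMap ∘ₗ
    (p ∘ₗ (LinearMap.ker (g ∘ₗ p)).subtype).codRestrict _ (fun x => (hig _).1 x.2)
  have hv : ∀ x, i (v x) = p x := fun x =>
    congrArg Subtype.val ((LinearEquiv.ofInjective i hi).apply_symm_apply _)
  refine ⟨v, fun a => ?_, hv⟩
  obtain ⟨x, hx⟩ := hp (i a)
  refine ⟨⟨x, ?_⟩, hi ?_⟩
  · rw [LinearMap.mem_ker, LinearMap.comp_apply, hx, hig.apply_apply_eq_zero]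
  · rw [hv, hx]

/-- The bound from the exact sequence `Tor_{n+1}(B) → Tor_{n+1}(C) → Tor_n(A)`. -/
theorem torLength_succ_le_add [IsNoetherianRing S] {A B C : Type u} [AddCommGroup A] [Module S A]
    [AddCommGroup B] [Module S B] [AddCommGroup C] [Module S C] [Module.Finite S A]
    [Module.Finite S B] {f : A →ₗ[S] B} {g : B →ₗ[S] C} (hf : Function.Injective f)
    (hfg : Function.Exact f g) (hg : Function.Surjective g) (n : ℕ) :
    torLength S C (n + 1) ≤ torLength S B (n + 1) + torLength S A n := by
  obtain ⟨b, p, hp, hpk⟩ := exists_minimal_cover S B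
  rw [torLength_succ_eq (Submodule.injective_subtype _) (LinearMap.exact_subtype_ker_map p) hp
    (by simpa using hpk)]
  refine (torLength_succ_le (Submodule.injective_subtype _)
    (LinearMap.exact_subtype_ker_map (g ∘ₗ p)) (hg.comp hp) n).trans ?_
  -- The syzygy of C through the cover of B is an extension of A by ker p, so half exactness applies
  -- to it.
  let u : LinearMap.ker p →ₗ[S] LinearMap.ker (g ∘ₗ p) :=
    Submodule.inclusion (LinearMap.ker_le_ker_comp p g)
  obtain ⟨v, hvs, hv⟩ := exists_ker_comp_to_syzygy hp hf hfg
  refine torLength_le_add (f := u) (g := v) (Submodule.inclusion_injective _) ?_ hvs n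
  intro x
  rw [← map_eq_zero_iff f hf, hv]
  exact ⟨fun h => ⟨⟨x, h⟩, rfl⟩, by rintro ⟨y, rfl⟩; exact y.2⟩

theorem torLength_pi_le [IsNoetherianRing S] [Module.Finite S M] (b n : ℕ) :
    torLength S (Fin b → M) n ≤ b * torLength S M n := by
  induction b with
  | zero => simp [torLength_of_subsingleton]
  | succ b ih =>
    let f : (Fin b → M) →ₗ[S] (Fin (b + 1) → M) :=
      LinearMap.pi (Fin.cases 0 fun i => LinearMap.proj i)
    refine (torLength_le_add (f := f) (g := LinearMap.proj 0) ?_ ?_ ?_ n).trans ?_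
    · intro x y hxy
      ext i
      exact congrFun hxy i.succ
    · intro x
      constructor
      · intro hx
        refine ⟨fun i => x i.succ, funext fun i => ?_⟩
        cases i using Fin.cases with
        | zero => exact hx.symm
        | succ i => rfl
      · rintro ⟨y, rfl⟩
        rfl
    · exact fun m => ⟨fun _ => m, rfl⟩
    · push_cast
      rw [add_mul, one_mul]
      exact add_le_add_left ih _

section Syzygy

variable [IsNoetherianRing S] {P N N' : Type u} [AddCommGroup P] [Module S P] [Module.Free S P]
  [Module.Finite S P] [AddCommGroup N] [Module S N] [AddCommGroup N'] [Module S N']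
  {p : P →ₗ[S] F} {i : N' →ₗ[S] F} {g : F →ₗ[S] N}

omit [IsNoetherianRing S] [Module.Finite S P] in
theorem torLength_syzygy_zero_le (hp : Function.Surjective p) (hi : Function.Injective i)
    (hig : Function.Exact i g) (hg : Function.Surjective g)
    (h : LinearMap.ker (g ∘ₗ p) ≤ IsLocalRing.maximalIdeal S • (⊤ : Submodule S P)) :
    torLength S N' 0 ≤ torLength S N 1 := by
  obtain ⟨v, hv, -⟩ := exists_ker_comp_to_syzygy hp hi hig
  rw [torLength_succ_eq (Submodule.injective_subtype _) (LinearMap.exact_subtype_ker_map (g ∘ₗ p))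
    (hg.comp hp) (by simpa using h)]
  exact torLength_zero_le_of_surjective v hv

/-- Apply `torLength_succ_le_add` to 0 → ker p → ker (g ∘ p) → N' → 0. Since ker p lies in ker (g ∘
p), both are minimal syzygies, of F and N, which accounts for the two shifts. -/
theorem torLength_syzygy_succ_le (hp : Function.Surjective p) (hi : Function.Injective i)
    (hig : Function.Exact i g) (hg : Function.Surjective g)
    (h : LinearMap.ker (g ∘ₗ p) ≤ IsLocalRing.maximalIdeal S • (⊤ : Submodule S P)) (n : ℕ) :
    torLength S N' (n + 1) ≤ torLength S N (n + 2) + torLength S F (n + 1) := by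
  obtain ⟨v, hv, hvp⟩ := exists_ker_comp_to_syzygy hp hi hig
  rw [torLength_succ_eq (Submodule.injective_subtype _) (LinearMap.exact_subtype_ker_map (g ∘ₗ p))
    (hg.comp hp) (by simpa using h), torLength_succ_eq (Submodule.injective_subtype _)
    (LinearMap.exact_subtype_ker_map p) hp
    (by simpa using (LinearMap.ker_le_ker_comp p g).trans h)]
  refine torLength_succ_le_add
    (f := Submodule.inclusion (LinearMap.ker_le_ker_comp p g)) (g := v)
    (Submodule.inclusion_injective _) ?_ hv n
  intro x
  rw [← map_eq_zero_iff i hi, hvp]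
  exact ⟨fun h => ⟨⟨x, h⟩, rfl⟩, by rintro ⟨y, rfl⟩; exact y.2⟩

end Syzygy

end TorLength

/-! ### Power series with nonnegative coefficients -/

section Coefficients

theorem coeff_mul_le {A B G : ℚ⟦X⟧} (hG : ∀ n, 0 ≤ coeff n G) {n : ℕ}
    (h : ∀ m ≤ n, coeff m A ≤ coeff m B) : coeff n (G * A) ≤ coeff n (G * B) := by
  rw [coeff_mul, coeff_mul]
  exact Finset.sum_le_sum fun x hx =>
    mul_le_mul_of_nonneg_left (h _ (by have := Finset.HasAntidiagonal.mem_antidiagonal.1 hx; lia)) (hG _)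

theorem one_sub_X_mul_mul_inv (A : ℚ⟦X⟧) : (1 - X * A) * (1 - X * A)⁻¹ = 1 :=
  PowerSeries.mul_inv_cancel _ (by simp)

theorem coeff_one_sub_X_mul_inv_nonneg {A : ℚ⟦X⟧} (hA : ∀ n, 0 ≤ coeff n A) (n : ℕ) :
    0 ≤ coeff n (1 - X * A)⁻¹ := by
  have h : (1 - X * A)⁻¹ = 1 + X * (A * (1 - X * A)⁻¹) := by
    linear_combination one_sub_X_mul_mul_inv A
  induction n using Nat.strong_induction_on with
  | _ n ih =>
    rw [h]
    cases n with
    | zero => simp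
    | succ n =>
      rw [map_add, coeff_succ_X_mul, coeff_one, if_neg n.succ_ne_zero, zero_add, coeff_mul]
      exact Finset.sum_nonneg fun x hx => mul_nonneg (hA _)
        (ih _ (Nat.lt_succ_of_le (by have := Finset.HasAntidiagonal.mem_antidiagonal.1 hx; lia)))

end Coefficients

/-! ### Poincaré coefficients as lengths -/

section Poincare

variable (S : Type u) [CommRing S] [IsLocalRing S] (M : Type u) [AddCommGroup M] [Module S M]

/-- The `S`-action factors through k, so length is k-rank. Both `toNat` and `finrank` send infinite
values to 0, hence no finiteness is needed. -/
theorem coeff_poincareSeries (n : ℕ) :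
    coeff n (poincareSeries S M) = ((torLength S M n).toNat : ℚ) := by
  have : IsScalarTower S (IsLocalRing.ResidueField S) (TorResidue S M n) :=
    IsScalarTower.of_algebraMap_smul fun r x => residue_smul_torResidue S M n r x
  rw [poincareSeries, coeff_mk, torLength,
    Module.length_eq_of_surjective (R := IsLocalRing.ResidueField S) IsLocalRing.residue_surjective,
    Module.length_eq_rank, Cardinal.toNat_toENat]
  rfl

end Poincare

/-! ### The key inequality, Serre's bound and the theorem -/

section Bound

variable {Q R : Type u} [CommRing Q] [IsLocalRing Q] [CommRing R]
  [IsLocalRing R] [Algebra Q R]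

theorem coeff_zero_poincareSeries_of_surjective (hφ : Function.Surjective (algebraMap Q R)) :
    coeff 0 (poincareSeries Q R) = 1 := by
  rw [coeff_poincareSeries, torLength_zero_eq_finrank (g := Algebra.linearMap Q R) hφ,
    Module.finrank_self]
  · simp
  · rw [Ideal.smul_eq_mul, Ideal.mul_top]
    exact IsLocalRing.le_maximalIdeal (RingHom.ker_ne_top (algebraMap Q R))

theorem coeff_poincareSeries_sub_one_nonneg (hφ : Function.Surjective (algebraMap Q R)) (n : ℕ) :
    0 ≤ coeff n (poincareSeries Q R - 1) := by
  rw [map_sub, coeff_one]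
  split_ifs with h
  · rw [h, coeff_zero_poincareSeries_of_surjective hφ, sub_self]
  · rw [coeff_poincareSeries, sub_zero]
    positivity

variable [IsNoetherianRing Q]
  {M : Type u} [AddCommGroup M] [Module Q M] [Module R M] [IsScalarTower Q R M]
  {G₀ : Type u} [AddCommGroup G₀] [Module Q G₀] {ε : G₀ →ₗ[Q] M}

omit [IsLocalRing R] [IsNoetherianRing Q] in
theorem IsMinimalFreeCover.liftBaseChange_surjective (hε : IsMinimalFreeCover ε) :
    Function.Surjective (ε.liftBaseChange R) := fun m => by
  obtain ⟨x, rfl⟩ := hε.surjective m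
  exact ⟨1 ⊗ₜ x, by simp⟩

omit [IsLocalRing R] [IsNoetherianRing Q] in
theorem IsMinimalFreeCover.ker_comp_le (hε : IsMinimalFreeCover ε) :
    LinearMap.ker ((ε.liftBaseChange R).restrictScalars Q ∘ₗ TensorProduct.mk Q R G₀ 1) ≤
      IsLocalRing.maximalIdeal Q • (⊤ : Submodule Q G₀) := by
  convert hε.ker_le
  ext x
  simp

omit [IsNoetherianRing Q] in
theorem syzygy_le (hφ : Function.Surjective (algebraMap Q R)) (hε : IsMinimalFreeCover ε) :
    syzygy R ε ≤ IsLocalRing.maximalIdeal R • (⊤ : Submodule R (R ⊗[Q] G₀)) := by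
  intro y hy
  obtain ⟨x, rfl⟩ := TensorProduct.mk_surjective Q G₀ R hφ y
  have hx : x ∈ LinearMap.ker ε := by simpa using hy
  replace hx := hε.ker_le hx
  have hloc : IsLocalHom (algebraMap Q R) := IsLocalHom.of_surjective _ hφ
  clear hy
  induction hx using Submodule.smul_induction_on' with
  | smul r hr n hn =>
    rw [LinearMap.map_smul, ← algebraMap_smul R r]
    exact Submodule.smul_mem_smul (map_nonunit (algebraMap Q R) r hr) trivial
  | add x hx y hy h1 h2 => rw [map_add]; exact add_mem h1 h2

omit [IsNoetherianRing Q] in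
variable (R) in
theorem X_mul_poincareSeries_syzygy (hφ : Function.Surjective (algebraMap Q R))
    (hε : IsMinimalFreeCover ε) :
    X * poincareSeries R (syzygy R ε) =
      poincareSeries R M - C (Module.finrank Q G₀ : ℚ) := by
  have := hε.free
  have := hε.finite
  have hle := syzygy_le hφ hε
  ext n
  cases n with
  | zero =>
    rw [map_sub, coeff_poincareSeries, torLength_zero_eq_finrank hε.liftBaseChange_surjective hle]
    simp
  | succ n =>
    rw [map_sub, coeff_succ_X_mul, coeff_poincareSeries, coeff_poincareSeries,
      torLength_succ_eq (Submodule.injective_subtype _)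
        (LinearMap.exact_subtype_ker_map (ε.liftBaseChange R)) hε.liftBaseChange_surjective
        (by simpa using hle), coeff_C, if_neg n.succ_ne_zero, sub_zero]

variable (R) in
theorem coeff_X_mul_poincareSeries_syzygy_le (hφ : Function.Surjective (algebraMap Q R))
    (hε : IsMinimalFreeCover ε) (n : ℕ) :
    coeff n (X * poincareSeries Q (syzygy R ε)) ≤
      coeff n (poincareSeries Q M -
        C (Module.finrank Q G₀ : ℚ) * (1 - X * (poincareSeries Q R - 1))) := by
  have := hε.free
  have := hε.finite
  have hQR : Module.Finite Q R := Module.Finite.of_surjective (Algebra.linearMap Q R) hφ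
  have hM : Module.Finite Q M := Module.Finite.of_surjective ε hε.surjective
  have hp := TensorProduct.mk_surjective Q G₀ R hφ
  let i : syzygy R ε →ₗ[Q] R ⊗[Q] G₀ := (syzygy R ε).subtype.restrictScalars Q
  have hi : Function.Injective i := Submodule.injective_subtype _
  have hig : Function.Exact i ((ε.liftBaseChange R).restrictScalars Q) :=
    LinearMap.exact_subtype_ker_map (ε.liftBaseChange R)
  have hg : Function.Surjective ((ε.liftBaseChange R).restrictScalars Q) :=
    hε.liftBaseChange_surjective
  rcases n with _ | _ | n
  · rw [map_sub, coeff_poincareSeries, torLength_zero_eq_finrank hε.surjective hε.ker_le]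
    simp
  · have h1 : (torLength Q (syzygy R ε) 0).toNat ≤ (torLength Q M 1).toNat :=
      ENat.toNat_le_toNat (torLength_syzygy_zero_le hp hi hig hg hε.ker_comp_le)
        (torLength_ne_top 1)
    rw [map_sub, coeff_succ_X_mul, coeff_C_mul, map_sub, coeff_succ_X_mul, map_sub,
      coeff_zero_poincareSeries_of_surjective hφ, coeff_poincareSeries, coeff_poincareSeries]
    simpa [coeff_one] using h1
  -- From degree 2 on, the term g·t(P^Q_R − 1) is what pays for the Tor of `R ⊗ G₀ ≅ R^g`.
  · have e : R ⊗[Q] G₀ ≃ₗ[Q] (Fin (Module.finrank Q G₀) → R) :=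
      ((Module.finBasis Q G₀).baseChange R).equivFun.restrictScalars Q
    have h1 : torLength Q (syzygy R ε) (n + 1) ≤
        torLength Q M (n + 2) + torLength Q (R ⊗[Q] G₀) (n + 1) :=
      torLength_syzygy_succ_le hp hi hig hg hε.ker_comp_le n
    rw [torLength_congr e] at h1
    replace h1 := h1.trans (add_le_add_right (torLength_pi_le _ (n + 1)) _)
    rw [← ENat.natCast_toNat (torLength_ne_top (S := Q) (M := M) (n + 2)),
      ← ENat.natCast_toNat (torLength_ne_top (S := Q) (M := R) (n + 1))] at h1
    -- The right side must be finite, as `toNat` sends ⊤ to 0.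
    replace h1 := ENat.toNat_le_toNat h1 (by
      rw [← Nat.cast_mul, ← Nat.cast_add]; exact ENat.natCast_ne_top _)
    rw [← Nat.cast_mul, ← Nat.cast_add, ENat.toNat_natCast] at h1
    rw [map_sub, coeff_succ_X_mul, coeff_C_mul, map_sub, coeff_succ_X_mul, map_sub,
      coeff_poincareSeries, coeff_poincareSeries, coeff_poincareSeries, coeff_one, coeff_one,
      if_neg (by simp), if_neg (by simp), zero_sub, sub_zero, mul_neg, sub_neg_eq_add]
    exact_mod_cast h1

variable (R) in
theorem coeff_X_mul_golodBound_syzygy_le (hφ : Function.Surjective (algebraMap Q R))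
    (hε : IsMinimalFreeCover ε) (n : ℕ) :
    coeff n (X * golodBound Q R (syzygy R ε)) ≤
      coeff n (golodBound Q R M - C (Module.finrank Q G₀ : ℚ)) := by
  have h := coeff_mul_le (n := n)
    (coeff_one_sub_X_mul_inv_nonneg (coeff_poincareSeries_sub_one_nonneg hφ))
    fun m _ => coeff_X_mul_poincareSeries_syzygy_le R hφ hε m
  have h1 := one_sub_X_mul_mul_inv (poincareSeries Q R - 1)
  unfold golodBound
  convert h using 2
  · ring
  · linear_combination (C (Module.finrank Q G₀ : ℚ)) * h1

omit [IsLocalRing R] in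
theorem finite_syzygy (hφ : Function.Surjective (algebraMap Q R)) (hε : IsMinimalFreeCover ε) :
    Module.Finite R (syzygy R ε) := by
  have := hε.finite
  have : IsNoetherianRing R := isNoetherianRing_of_surjective Q R (algebraMap Q R) hφ
  infer_instance

/-- Serre's bound: the Poincaré series of a module is at most the Golod bound. -/
theorem coeff_poincareSeries_le_golodBound (hφ : Function.Surjective (algebraMap Q R)) (n : ℕ)
    (N : Type u) [AddCommGroup N] [Module Q N] [Module R N] [IsScalarTower Q R N]
    [Module.Finite Q N] : coeff n (poincareSeries R N) ≤ coeff n (golodBound Q R N) := by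
  have hQR : Module.Finite Q R := Module.Finite.of_surjective (Algebra.linearMap Q R) hφ
  induction n generalizing N with
  | zero =>
    obtain ⟨b, ε, hs, hk⟩ := exists_minimal_cover Q N
    have hε : IsMinimalFreeCover ε := ⟨inferInstance, inferInstance, hs, hk⟩
    have h1 := coeff_X_mul_golodBound_syzygy_le R hφ hε 0
    have h2 := congrArg (coeff 0) (X_mul_poincareSeries_syzygy R hφ hε)
    rw [map_sub, coeff_zero_X_mul] at h1 h2
    linarith
  | succ n ih =>
    obtain ⟨b, ε, hs, hk⟩ := exists_minimal_cover Q N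
    have hε : IsMinimalFreeCover ε := ⟨inferInstance, inferInstance, hs, hk⟩
    have h1 := coeff_X_mul_golodBound_syzygy_le R hφ hε (n + 1)
    have h2 := congrArg (coeff (n + 1)) (X_mul_poincareSeries_syzygy R hφ hε)
    rw [map_sub, coeff_succ_X_mul] at h1 h2
    have := finite_syzygy hφ hε
    have : Module.Finite Q (syzygy R ε) := Module.Finite.trans R _
    have h3 := ih (syzygy R ε)
    linarith

end Bound
end GolodMod

end

theorem mainTheorem10
    (Q R : Type u) [CommRing Q] [IsLocalRing Q] [IsNoetherianRing Q]
    [CommRing R] [IsLocalRing R] [Algebra Q R]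
    (hφ : Function.Surjective (algebraMap Q R))
    (M : Type u) [AddCommGroup M] [Module Q M] [Module R M] [IsScalarTower Q R M]
    (G₀ : Type u) [AddCommGroup G₀] [Module Q G₀]
    (ε : G₀ →ₗ[Q] M) (hε : GolodMod.IsMinimalFreeCover ε)
    (hM : GolodMod.IsGolod Q R M) :
    GolodMod.IsGolod Q R (GolodMod.syzygy R ε) := by
  have hfin := GolodMod.finite_syzygy hφ hε
  have hQR : Module.Finite Q R := Module.Finite.of_surjective (Algebra.linearMap Q R) hφ
  have hfinQ : Module.Finite Q (GolodMod.syzygy R ε) := Module.Finite.trans R _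
  refine ⟨hfin, PowerSeries.ext fun n =>
    le_antisymm (GolodMod.coeff_poincareSeries_le_golodBound hφ n _) ?_⟩
  -- Degree n + 1 absorbs the factor t. Since M attains its bound, the right side becomes t·P^R_{syz
  -- M}, which reverses Serre's inequality.
  have h := GolodMod.coeff_X_mul_golodBound_syzygy_le R hφ hε (n + 1)
  rwa [← hM.2, ← GolodMod.X_mul_poincareSeries_syzygy R hφ hε, PowerSeries.coeff_succ_X_mul,
    PowerSeries.coeff_succ_X_mul] at h
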